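/- A \emph{large graph} is a sequence $(G_k)_{k\ge 0}$ of finite simple graphs whose orders $n=|V(G_k)|$ tend to infinity; $o(1)$ refers to $k\to\infty$. A \emph{labeled copy} of $H$ in $G$ is an injective map $V(H)\to V(G)$ that maps edges to edges. For $0<p<1$, a large graph is \emph{$p$-quasirandom} if it satisfies one of the following properties (which are equivalent by a theorem of Chung, Graham and Wilson): (P1) it has $(1+o(1))pn^2$ labeled edges (ordered pairs of adjacent vertices) and $(1+o(1))p^4n^4$ labeled copies of the $4$-cycle $C_4$; (P2) for every fixed finite graph $H$ it has $(1+o(1))p^{|E(H)|}n^{|V(H)|}$ labeled copies of $H$; (P3) for every $c>0$, the number of labeled edges between vertices of $S$ is $(1+o(1))p|S|^2$, uniformly over all vertex sets $S$ with $|S|\ge cn$. A family $\mathcal F$ of finite graphs is \emph{forcing for $p$} if every large graph that has $(1+o(1))p^{|E(F)|}n^{|V(F)|}$ labeled copies of $F$ for every $F\in\mathcal F$ is $p$-quasirandom, and it is \emph{forcing} if it is forcing for every $0<p<1$. \textbf{Theorem.} The infinite family of all cliques $\mathcal K=\{K_2,K_3,\dots\}$ is not forcing; indeed, it is not forcing for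 any $0<p<1$. Moreover, for every $0<p<1$ there is a large graph that has $(1+o(1))p^{\binom j2}n^j$ labeled copies of $K_j$ for every $j\ge 2$ (the $o(1)$ may depend on $j$), each of whose members has an independent set of size at least $(1-p)n/2$, and which is not $p$-quasirandom. -/

import Mathlib

open Filter Asymptotics

/-- A "large graph": a sequence of finite graphs whose numbers of vertices tend to infinity. -/
structure LargeGraph where
  /-- the number of vertices of the `k`-th graph -/
  order : ℕ → ℕ
  /-- the `k`-th graph -/
  graph : (k : ℕ) → SimpleGraph (Fin (order k))
  tendsto_order : Tendsto order atTop atTop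

namespace LargeGraph

/-- The number of labeled copies (injective maps `V(H) → V(G)` that map edges to edges) of the
fixed graph `H` in `G` is `(1 + o(1)) p ^ |E(H)| n ^ |V(H)|`. -/
def HasCorrectCount (G : LargeGraph) (p : ℝ) {m : ℕ} (H : SimpleGraph (Fin m)) : Prop :=
  (fun k => ((G.graph k).labelledCopyCount H : ℝ)) ~[atTop]
    (fun k => p ^ H.edgeSet.ncard * (G.order k : ℝ) ^ m)

/-- The number of labeled edges of a graph between vertices of `S`, that is, of ordered pairs of
adjacent vertices of `S`. -/
noncomputable def labeledEdgesIn {V : Type*} (G : SimpleGraph V) (S : Finset V) : ℕ :=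
  {e : V × V | e.1 ∈ S ∧ e.2 ∈ S ∧ G.Adj e.1 e.2}.ncard

/-- Edges and 4-cycles: there are `(1 + o(1)) p n ^ 2` labeled edges and `(1 + o(1)) p ^ 4 n ^ 4`
labeled copies of `C_4`. -/
def PropertyOne (G : LargeGraph) (p : ℝ) : Prop :=
  ((fun k => (labeledEdgesIn (G.graph k) Finset.univ : ℝ)) ~[atTop]
    (fun k => p * (G.order k : ℝ) ^ 2)) ∧
  ((fun k => ((G.graph k).labelledCopyCount (SimpleGraph.cycleGraph 4) : ℝ)) ~[atTop]
    (fun k => p ^ 4 * (G.order k : ℝ) ^ 4))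

/-- All subgraph counts: every fixed graph `H` has `(1 + o(1)) p ^ |E(H)| n ^ |V(H)|` labeled
copies. -/
def PropertyTwo (G : LargeGraph) (p : ℝ) : Prop :=
  ∀ (m : ℕ) (H : SimpleGraph (Fin m)), G.HasCorrectCount p H

/-- Edge distribution: for every `c > 0`, every vertex set `S` of size at least `c n` spans
`(1 + o(1)) p |S| ^ 2` labeled edges, where the `o(1)` is uniform in `S`. -/
def PropertyThree (G : LargeGraph) (p : ℝ) : Prop :=
  ∀ c : ℝ, 0 < c → ∀ ε : ℝ, 0 < ε → ∀ᶠ k in atTop, ∀ S : Finset (Fin (G.order k)),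
    c * (G.order k : ℝ) ≤ (S.card : ℝ) →
      |(labeledEdgesIn (G.graph k) S : ℝ) - p * (S.card : ℝ) ^ 2| ≤
        ε * (p * (S.card : ℝ) ^ 2)

/-- A large graph is `p`-quasirandom if it satisfies one of the three properties (which, by the
theorem of Chung, Graham and Wilson, are equivalent for `0 < p < 1`). -/
def IsQuasirandom (G : LargeGraph) (p : ℝ) : Prop :=
  G.PropertyOne p ∨ G.PropertyTwo p ∨ G.PropertyThree p

end LargeGraph

/-- A family of finite graphs, given up to isomorphism by graphs on the vertex sets `Fin m`. -/
abbrev GraphFamily : Type := Set (Σ m : ℕ, SimpleGraph (Fin m))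

namespace GraphFamily

/-- `F` is forcing for the density `p`: every large graph with the correct number of labeled
copies of every member of `F` is `p`-quasirandom. -/
def IsForcingAt (F : GraphFamily) (p : ℝ) : Prop :=
  ∀ G : LargeGraph, (∀ H ∈ F, G.HasCorrectCount p H.2) → G.IsQuasirandom p

/-- A family is forcing if it is so for every density `0 < p < 1`. -/
def IsForcing (F : GraphFamily) : Prop :=
  ∀ p : ℝ, 0 < p → p < 1 → IsForcingAt F p

/-- The family `{K_2, K_3, ...}` of all cliques. -/
def cliques : GraphFamily :=
  {H | ∃ j : ℕ, 2 ≤ j ∧ H = ⟨j, (⊤ : SimpleGraph (Fin j))⟩}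

end GraphFamily

/-!
The graphs are complete multipartite. If the parts of such a graph are fractions `α i` of the
vertices, then the density of labelled copies of `K_j` is `j !` times the `j`-th elementary
symmetric function of the `α i`, up to `o(1)`. So the densities `p ^ (j choose 2)` are realised for
all `j` at once if the power series `∑ p ^ (j choose 2) x ^ j / j !` is a product of factors
`1 + α i x`, that is, if all of its zeros are real and negative. Only finite approximations are
needed: the polynomials `∑ (N choose j) p ^ (j choose 2) x ^ j` (`deformedExp`) satisfy
`P (N + 1) x = P N x + x * P N (p x)`, and an interlacing argument along this recursion shows that
their roots are real, negative and separated by factors of more than `1 / p`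
(`exists_deformedExp_eq_prod`). Rescaling `x` by `1 / N` turns them into weights whose elementary
symmetric functions tend to the required ones (`exists_weights`), and rounding the sizes of the
parts gives graphs (`exists_multipartite_approx`).

The edge density forces a large part: `∑ (α i) ^ 2` is close to `1 - p`, so the largest `α i` is at
least about `1 - p`, and the corresponding part is an independent set. It refutes the edge
distribution property. The other two properties that define quasirandomness fail because the graphs
have too many 4-cycles: in a complete multipartite graph, the number of pairs of labelled edges plus
that of labelled 4-cliques is twice that of labelled 4-cycles, up to `O(n ^ 3)`
(`edge_sq_add_clique_four_le` is the inequality that is needed), so the density of 4-cycles is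
asymptotically at least `(p ^ 2 + p ^ 6) / 2 > p ^ 4`.
-/

/-! ### Roots of the deformed exponential polynomials -/

section DeformedExponential

open Polynomial

/-- The polynomial `∑ j, (N choose j) p ^ (j choose 2) X ^ j`, given by its recursion in `N`. -/
noncomputable def deformedExp (p : ℝ) : ℕ → ℝ[X]
  | 0 => 1
  | N + 1 => deformedExp p N + X * (deformedExp p N).comp (C p * X)

lemma coeff_deformedExp (p : ℝ) (N j : ℕ) :
    (deformedExp p N).coeff j = N.choose j * p ^ j.choose 2 := by
  induction N generalizing j with
  | zero => cases j <;> simp [deformedExp, coeff_one]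
  | succ N ih =>
    cases j with
    | zero => simp [deformedExp, ih]
    | succ j =>
      rw [deformedExp, coeff_add, coeff_X_mul, comp_C_mul_X_coeff, ih, ih, Nat.choose_succ_succ N j,
        Nat.choose_succ_succ j 1]
      push_cast [Nat.choose_one_right]
      ring

lemma eval_deformedExp_succ (p : ℝ) (N : ℕ) (x : ℝ) :
    (deformedExp p (N + 1)).eval x =
      (deformedExp p N).eval x + x * (deformedExp p N).eval (p * x) := by
  simp [deformedExp]

lemma natDegree_deformedExp_le (p : ℝ) (N : ℕ) : (deformedExp p N).natDegree ≤ N := by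
  rw [natDegree_le_iff_coeff_eq_zero]
  intro j hj
  rw [coeff_deformedExp, Nat.choose_eq_zero_of_lt hj]
  simp

lemma tendsto_eval_neg_deformedExp {p : ℝ} (hp : 0 < p) (N : ℕ) :
    Tendsto (fun t : ℝ => (-1) ^ (N + 1) * (deformedExp p (N + 1)).eval (-t)) atTop atTop := by
  set Q : ℝ[X] := C ((-1) ^ (N + 1)) * (deformedExp p (N + 1)).comp (C (-1) * X) with hQ
  have hcoeff : ∀ j, Q.coeff j =
      (-1) ^ (N + 1) * ((N + 1).choose j * p ^ j.choose 2 * (-1) ^ j) := fun j => by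
    rw [hQ, coeff_C_mul, comp_C_mul_X_coeff, coeff_deformedExp]
  have htop : Q.coeff (N + 1) = p ^ (N + 1).choose 2 := by
    have h : ((-1 : ℝ) ^ (N + 1)) * (-1) ^ (N + 1) = 1 := by
      rw [← mul_pow]
      simp
    rw [hcoeff, Nat.choose_self, Nat.cast_one, one_mul, mul_left_comm, h, mul_one]
  have hne : Q.coeff (N + 1) ≠ 0 := htop ▸ (pow_pos hp _).ne'
  have hdeg : Q.natDegree = N + 1 := by
    refine natDegree_eq_of_le_of_coeff_ne_zero ?_ hne
    rw [natDegree_le_iff_coeff_eq_zero]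
    intro j hj
    rw [hcoeff, Nat.choose_eq_zero_of_lt hj]
    simp
  have := Q.tendsto_atTop_of_leadingCoeff_nonneg
    (natDegree_pos_iff_degree_pos.1 (by omega))
    (by rw [leadingCoeff, hdeg, htop]; positivity)
  simpa [hQ, eval_comp] using this

/-- The sign of `∏ (1 - t / r k)` when exactly the first `i` of the numbers `r k` are below `t`. -/
lemma sign_prod_one_sub {N i : ℕ} (hi : i ≤ N) {r : ℕ → ℝ} (hr : ∀ k, 0 < r k) {t : ℝ}
    (hlt : ∀ k < i, r k < t) (hgt : ∀ k, i ≤ k → k < N → t < r k) :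
    0 < (-1) ^ i * ∏ k ∈ Finset.range N, (1 + 1 / r k * -t) := by
  have h : ((-1 : ℝ)) ^ i = ∏ _k ∈ Finset.range i, (-1 : ℝ) := by simp
  rw [← Finset.prod_range_mul_prod_Ico _ hi, ← mul_assoc, h, ← Finset.prod_mul_distrib]
  refine mul_pos (Finset.prod_pos fun k hk => ?_) (Finset.prod_pos fun k hk => ?_)
  · have := (one_lt_div (hr k)).2 (hlt k (Finset.mem_range.1 hk))
    have h2 : 1 / r k * -t = - (t / r k) := by ring
    rw [h2]
    linarith
  · have hk := Finset.mem_Ico.1 hk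
    have := (div_lt_one (hr k)).2 (hgt k hk.1 hk.2)
    have h2 : 1 / r k * -t = - (t / r k) := by ring
    rw [h2]
    linarith

/-- A positive sequence with consecutive ratios above `1 / p`. -/
structure IsLacunary (p : ℝ) (r : ℕ → ℝ) : Prop where
  zero_pos : 0 < r 0
  lt_mul_succ : ∀ i, r i < p * r (i + 1)

namespace IsLacunary

variable {p : ℝ} {r : ℕ → ℝ}

lemma pos (h : IsLacunary p r) (hp : 0 < p) (i : ℕ) : 0 < r i := by
  induction i with
  | zero => exact h.zero_pos
  | succ i ih => exact pos_of_mul_pos_right (ih.trans (h.lt_mul_succ i)) hp.le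

lemma strictMono (h : IsLacunary p r) (hp : 0 < p) (hp1 : p < 1) : StrictMono r :=
  strictMono_nat_of_lt_succ fun i => (h.lt_mul_succ i).trans
    (mul_lt_of_lt_one_left (h.pos hp _) hp1)

/-- The terms from the `N`-th on can be moved beyond any bound. -/
lemma exists_large (h : IsLacunary p r) (hp : 0 < p) (N : ℕ) (T : ℝ) :
    ∃ r', IsLacunary p r' ∧ (∀ i < N, r' i = r i) ∧ T ≤ r' N := by
  set M := max 1 (T / r N) with hM
  have hM1 : 1 ≤ M := le_max_left _ _
  refine ⟨fun i => if i < N then r i else M * r i, ⟨?_, fun i => ?_⟩, fun i hi => if_pos hi, ?_⟩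
  · have := h.zero_pos
    split_ifs <;> positivity
  · have h1 := h.lt_mul_succ i
    have h2 := h.pos hp i
    have h3 := h.pos hp (i + 1)
    have h4 : p * r (i + 1) ≤ p * (M * r (i + 1)) := by
      gcongr
      exact le_mul_of_one_le_left h3.le hM1
    split_ifs
    · exact h1
    · exact h1.trans_le h4
    · omega
    · calc M * r i < M * (p * r (i + 1)) := by gcongr
        _ = p * (M * r (i + 1)) := by ring
  · simp only [lt_irrefl, if_false]
    exact (div_le_iff₀ (h.pos hp N)).1 (le_max_right _ _)

end IsLacunary

/-- `deformedExp p N` splits over the reals, with negative and lacunary roots `-r i`. The inductive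
step locates the next roots by the intermediate value theorem: `deformedExp p (N + 1)` has the same
sign at `-r i` and at `-r i / p`, and this sign alternates with `i`. -/
theorem exists_deformedExp_eq_prod {p : ℝ} (hp : 0 < p) (hp1 : p < 1) (N : ℕ) :
    ∃ r : ℕ → ℝ, IsLacunary p r ∧
      deformedExp p N = ∏ i ∈ Finset.range N, (1 + C (1 / r i) * X) := by
  induction N with
  | zero =>
    refine ⟨fun i => (2 / p) ^ i, ⟨by simp, fun i => ?_⟩, by simp [deformedExp]⟩
    have : 0 < (2 / p) ^ i := by positivity
    have h2 : p * (2 / p) ^ (i + 1) = 2 * (2 / p) ^ i := by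
      rw [pow_succ]
      field_simp
    linarith
  | succ N ih =>
    obtain ⟨r₀, hr₀, hprod₀⟩ := ih
    obtain ⟨T, hT⟩ :=
      ((tendsto_eval_neg_deformedExp hp N).eventually_gt_atTop 0).exists_forall_of_atTop
    obtain ⟨r, hr, hrr, hTr⟩ := hr₀.exists_large hp N T
    have hprod : deformedExp p N = ∏ i ∈ Finset.range N, (1 + C (1 / r i) * X) := by
      rw [hprod₀]
      exact Finset.prod_congr rfl fun i hi => by rw [hrr i (Finset.mem_range.1 hi)]
    have hpos := hr.pos hp
    have hmono := hr.strictMono hp hp1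
    have heval : ∀ t, (deformedExp p N).eval (-t) =
        ∏ k ∈ Finset.range N, (1 + 1 / r k * -t) := fun t => by
      rw [hprod, eval_prod]
      simp
    have hroot : ∀ i < N, (deformedExp p N).eval (-r i) = 0 := fun i hi => by
      rw [heval]
      refine Finset.prod_eq_zero (Finset.mem_range.2 hi) ?_
      have := (hpos i).ne'
      field_simp
      ring
    set F : ℝ → ℝ := fun t => (deformedExp p (N + 1)).eval (-t) with hF
    have hFrec : ∀ t, F t = (deformedExp p N).eval (-t) - t * (deformedExp p N).eval (-(p * t)) :=
      fun t => by
        rw [hF]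
        dsimp only
        rw [eval_deformedExp_succ, mul_neg]
        ring
    have hFcont : Continuous F := by
      rw [hF]
      fun_prop
    -- The left end of the interval in which the `i`-th new root is found.
    set lo : ℕ → ℝ := fun i => Nat.casesOn i 0 fun k => r k / p with hlo
    have hlo_lt : ∀ i, lo i < r i := fun i => by
      cases i with
      | zero => exact hpos 0
      | succ i => exact (div_lt_iff₀' hp).2 (hr.lt_mul_succ i)
    have hsign_lo : ∀ i ≤ N, 0 < (-1) ^ i * F (lo i) := fun i hi => by
      cases i with
      | zero =>
        have : F 0 = 1 := by
          rw [hF]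
          dsimp only
          rw [neg_zero, ← coeff_zero_eq_eval_zero, coeff_deformedExp]
          simp
        simp [hlo, this]
      | succ i =>
        have h1 : p * (r i / p) = r i := by field_simp
        have h2 : F (lo (i + 1)) = ∏ k ∈ Finset.range N, (1 + 1 / r k * -lo (i + 1)) := by
          rw [hFrec, ← heval]
          change _ - _ * (deformedExp p N).eval (-(p * (r i / p))) = _
          rw [h1, hroot i (by omega)]
          ring
        rw [h2]
        refine sign_prod_one_sub hi hpos (fun k hk => ?_) fun k hk _ =>
          (hlo_lt (i + 1)).trans_le (hmono.monotone hk)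
        exact (hmono.monotone (Nat.lt_succ_iff.1 hk)).trans_lt
          ((lt_div_iff₀ hp).2 (mul_lt_of_lt_one_right (hpos i) hp1))
    have hsign_hi : ∀ i ≤ N, (-1) ^ i * F (r i) < 0 := fun i hi => by
      rcases hi.lt_or_eq with hi | rfl
      · have h1 : F (r i) = - r i * ∏ k ∈ Finset.range N, (1 + 1 / r k * -(p * r i)) := by
          rw [hFrec, hroot i hi, heval]
          ring
        have h2 := sign_prod_one_sub (t := p * r i) hi.le hpos
          (fun k hk => (hr.lt_mul_succ k).trans_le
            (mul_le_mul_of_nonneg_left (hmono.monotone hk) hp.le))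
          (fun k hk _ => (mul_lt_of_lt_one_left (hpos i) hp1).trans_le (hmono.monotone hk))
        rw [h1]
        nlinarith [mul_pos (hpos i) h2]
      · have := hT _ hTr
        rw [pow_succ] at this
        change 0 < _ * F (r i) at this
        linarith
    have hex : ∀ i, ∃ s, lo i < s ∧ s < r i ∧ (i ≤ N → F s = 0) := fun i => by
      by_cases hi : i ≤ N
      · have hc : ContinuousOn (fun t => (-1) ^ i * F t) (Set.Icc (lo i) (r i)) := by fun_prop
        obtain ⟨s, hs, hs0⟩ := intermediate_value_Ioo' (hlo_lt i).le hc
          ⟨hsign_hi i hi, hsign_lo i hi⟩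
        refine ⟨s, hs.1, hs.2, fun _ => ?_⟩
        simpa using hs0
      · obtain ⟨s, hs⟩ := exists_between (hlo_lt i)
        exact ⟨s, hs.1, hs.2, fun h => absurd h hi⟩
    choose s hs_lo hs_hi hs0 using hex
    have hs : IsLacunary p s :=
      ⟨hs_lo 0, fun i => (hs_hi i).trans ((div_lt_iff₀' hp).1 (hs_lo (i + 1)))⟩
    have hspos := hs.pos hp
    refine ⟨s, hs, ?_⟩
    -- Both sides have degree at most `N + 1` and agree at `0` and at the `N + 1` points `-s i`.
    set f : Option (Fin (N + 1)) → ℝ := fun o => o.elim 0 fun i => -s i with hf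
    refine eq_of_natDegree_lt_card_of_eval_eq _ _ (f := f) ?_ ?_ ?_
    · rintro (_ | i) (_ | j) h
      · rfl
      · exact absurd h (by simpa [hf] using (hspos j).ne')
      · exact absurd h (by simpa [hf] using (hspos i).ne')
      · have : s i = s j := neg_injective h
        rw [Fin.ext ((hs.strictMono hp hp1).injective this)]
    · rintro (_ | i)
      · have : (deformedExp p (N + 1)).eval 0 = 1 := by
          rw [← coeff_zero_eq_eval_zero, coeff_deformedExp]
          simp
        simp [hf, this, eval_prod]
      · have h1 : (deformedExp p (N + 1)).eval (-s i) = 0 := hs0 i (by omega)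
        simp only [hf, Option.elim]
        rw [h1, eval_prod]
        refine (Finset.prod_eq_zero (Finset.mem_range.2 i.2) ?_).symm
        have := (hspos i).ne'
        simp [this]
    · have h1 := natDegree_deformedExp_le p (N + 1)
      have h2 : (∏ i ∈ Finset.range (N + 1), (1 + C (1 / s i) * X)).natDegree ≤ N + 1 := by
        refine (natDegree_prod_le _ _).trans
          ((Finset.sum_le_sum (g := fun _ => 1) fun i _ => ?_).trans (by simp))
        rw [add_comm]
        exact natDegree_linear_le
      simp only [Fintype.card_option, Fintype.card_fin]
      omega

/-- Summing over injections of `j` indices counts every term of the elementary symmetric function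
`j !` times. -/
lemma sum_embedding_prod {ι : Type*} [Fintype ι] (α : ι → ℝ) (j : ℕ) :
    ∑ g : Fin j ↪ ι, ∏ a, α (g a) =
      j.factorial * ∑ s ∈ Finset.powersetCard j Finset.univ, ∏ i ∈ s, α i := by
  classical
  have hmaps : ∀ g ∈ (Finset.univ : Finset (Fin j ↪ ι)),
      Finset.univ.map g ∈ Finset.powersetCard j (Finset.univ : Finset ι) := fun g _ => by
    simp [Finset.mem_powersetCard]
  rw [← Finset.sum_fiberwise_of_maps_to hmaps, Finset.mul_sum]
  refine Finset.sum_congr rfl fun s hs => ?_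
  have hcard : s.card = j := (Finset.mem_powersetCard.1 hs).2
  have hfib : (Finset.univ.filter fun g : Fin j ↪ ι => Finset.univ.map g = s).card =
      j.factorial := by
    have hiff : ∀ g : Fin j ↪ ι, Finset.univ.map g = s ↔ ∀ a, g a ∈ s := fun g => by
      constructor
      · rintro rfl a
        simp
      · intro h
        refine Finset.eq_of_subset_of_card_le ?_ (by simp [hcard])
        intro x hx
        obtain ⟨a, -, rfl⟩ := Finset.mem_map.1 hx
        exact h a
    have e : {g : Fin j ↪ ι // Finset.univ.map g = s} ≃ (Fin j ↪ s) :=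
      { toFun := fun g => ⟨fun a => ⟨g.1 a, (hiff g.1).1 g.2 a⟩,
          fun a b hab => g.1.injective (congrArg Subtype.val hab)⟩
        invFun := fun g => ⟨g.trans (Function.Embedding.subtype _),
          (hiff _).2 fun a => (g a).2⟩
        left_inv := fun g => by ext; rfl
        right_inv := fun g => by ext; rfl }
    rw [← Fintype.card_subtype, Fintype.card_congr e, Fintype.card_embedding_eq]
    simp [hcard, Nat.descFactorial_self]
  rw [Finset.sum_congr rfl (g := fun _ => ∏ i ∈ s, α i), Finset.sum_const, hfib, nsmul_eq_mul]
  intro g hg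
  rw [← (Finset.mem_filter.1 hg).2, Finset.prod_map]

/-- The elementary symmetric functions of the numbers `α i` are the coefficients of the product
of the polynomials `1 + α i X`. -/
lemma coeff_prod_one_add_C_mul_X {ι : Type*} [Fintype ι] (α : ι → ℝ) (j : ℕ) :
    (∏ i, (1 + C (α i) * X)).coeff j =
      ∑ s ∈ Finset.powersetCard j Finset.univ, ∏ i ∈ s, α i := by
  classical
  have h : ∀ s : Finset ι, (∏ i ∈ s, (C (α i) * X)).coeff j =
      if s.card = j then ∏ i ∈ s, α i else 0 := fun s => by
    rw [Finset.prod_mul_distrib, Finset.prod_const, ← map_prod, coeff_C_mul_X_pow]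
    simp only [eq_comm]
  rw [Finset.prod_one_add, finsetSum_coeff, Finset.sum_congr rfl fun s _ => h s,
    ← Finset.sum_filter, Finset.powersetCard_eq_filter]

/-- Weights on `N` parts for which the complete multipartite graph has the right clique
densities, up to the factors `N (N - 1) ⋯ (N - j + 1) / N ^ j`. -/
theorem exists_weights {p : ℝ} (hp : 0 < p) (hp1 : p < 1) (N : ℕ) :
    ∃ α : Fin N → ℝ, (∀ i, 0 ≤ α i) ∧ ∀ j : ℕ,
      ∑ g : Fin j ↪ Fin N, ∏ a, α (g a) =
        p ^ j.choose 2 * ((N.descFactorial j : ℝ) / (N : ℝ) ^ j) := by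
  obtain ⟨r, hr, hprod⟩ := exists_deformedExp_eq_prod hp hp1 N
  refine ⟨fun i => 1 / r i / N, fun i => ?_, fun j => ?_⟩
  · have := hr.pos hp i
    positivity
  · have h1 : ∀ g : Fin j ↪ Fin N, ∏ a, (1 / r (g a) / N) = (∏ a, 1 / r (g a)) / (N : ℝ) ^ j :=
      fun g => by rw [Finset.prod_div_distrib]; simp
    rw [Finset.sum_congr rfl fun g _ => h1 g, ← Finset.sum_div,
      sum_embedding_prod (fun i : Fin N => 1 / r i), ← coeff_prod_one_add_C_mul_X,
      Fin.prod_univ_eq_prod_range (fun i => 1 + C (1 / r i) * X) N, ← hprod, coeff_deformedExp,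
      Nat.descFactorial_eq_factorial_mul_choose]
    push_cast
    ring

end DeformedExponential

/-! ### Copies of cliques and of the 4-cycle in complete multipartite graphs -/

section MultipartiteCounts

open SimpleGraph

lemma labelledCopyCount_eq_card {V W : Type*} [Fintype V] [Fintype W]
    (G : SimpleGraph V) (H : SimpleGraph W) :
    G.labelledCopyCount H = Nat.card {f : W → V //
      Function.Injective f ∧ ∀ a b, H.Adj a b → G.Adj (f a) (f b)} := by
  classical
  rw [labelledCopyCount, ← Nat.card_eq_fintype_card]
  exact Nat.card_congr
    { toFun := fun f => ⟨f, f.injective, fun a b h => f.toHom.map_adj h⟩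
      invFun := fun f => ⟨⟨f.1, fun h => f.2.2 _ _ h⟩, f.2.1⟩
      left_inv := fun f => rfl
      right_inv := fun f => rfl }

/-- In a complete multipartite graph, given by the colouring `c` of its vertices by the parts, the
labelled copies of a clique are sorted by the injection that tells the part of each vertex. -/
lemma labelledCopyCount_top_comap {V ι : Type*} [Fintype V] [Fintype ι] [DecidableEq ι]
    (c : V → ι) (j : ℕ) :
    ((⊤ : SimpleGraph ι).comap c).labelledCopyCount (⊤ : SimpleGraph (Fin j)) =
      ∑ g : Fin j ↪ ι, ∏ a, Fintype.card {v // c v = g a} := by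
  classical
  have h : Fintype.card (Σ g : Fin j ↪ ι, (a : Fin j) → {v // c v = g a}) =
      ∑ g : Fin j ↪ ι, ∏ a, Fintype.card {v // c v = g a} := by
    rw [Fintype.card_sigma]
    exact Finset.sum_congr rfl fun g _ => Fintype.card_pi
  rw [← h, labelledCopyCount_eq_card, ← Nat.card_eq_fintype_card]
  symm
  refine Nat.card_eq_of_bijective (fun x => ⟨fun a => (x.2 a).1, ?_, ?_⟩) ⟨?_, ?_⟩
  · intro a b hab
    refine x.1.injective ?_
    rw [← (x.2 a).2, ← (x.2 b).2]
    exact congrArg c hab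
  · intro a b hab
    rw [comap_adj, top_adj, (x.2 a).2, (x.2 b).2]
    exact x.1.injective.ne hab
  · rintro ⟨g, x⟩ ⟨g', x'⟩ hx
    have hx : ∀ a, (x a).1 = (x' a).1 := fun a => congrFun (congrArg Subtype.val hx) a
    obtain rfl : g = g' := by
      ext a
      rw [← (x a).2, ← (x' a).2, hx]
    rw [Sigma.mk.injEq]
    exact ⟨rfl, heq_of_eq (funext fun a => Subtype.ext (hx a))⟩
  · rintro ⟨f, hf, hadj⟩
    refine ⟨⟨⟨fun a => c (f a), fun a b hab => ?_⟩, fun a => ⟨f a, rfl⟩⟩, rfl⟩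
    by_contra hne
    exact hadj a b hne hab

lemma exists_colouring {N : ℕ} (m : Fin N → ℕ) :
    ∃ c : Fin (∑ i, m i) → Fin N, ∀ i, Fintype.card {v // c v = i} = m i := by
  refine ⟨fun v => (finSigmaFinEquiv.symm v).1, fun i => ?_⟩
  have e : {v : Fin (∑ i, m i) // (finSigmaFinEquiv.symm v).1 = i} ≃ Fin (m i) :=
    (finSigmaFinEquiv.symm.subtypeEquiv fun v => Iff.rfl).trans
      (Equiv.sigmaSubtype i)
  rw [Fintype.card_congr e, Fintype.card_fin]

/-- The values of a map on four vertices, as two pairs. -/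
def finFourArrowEquiv (V : Type*) : (Fin 4 → V) ≃ (V × V) × (V × V) where
  toFun f := ((f 0, f 1), (f 2, f 3))
  invFun q := ![q.1.1, q.1.2, q.2.1, q.2.2]
  left_inv f := by
    ext i
    fin_cases i <;> rfl
  right_inv q := rfl

@[simp]
lemma finFourArrowEquiv_apply {V : Type*} (f : Fin 4 → V) :
    finFourArrowEquiv V f = ((f 0, f 1), (f 2, f 3)) := rfl

lemma injective_fin_four_iff {V : Type*} (f : Fin 4 → V) : Function.Injective f ↔
    f 0 ≠ f 1 ∧ f 0 ≠ f 2 ∧ f 0 ≠ f 3 ∧ f 1 ≠ f 2 ∧ f 1 ≠ f 3 ∧ f 2 ≠ f 3 := by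
  constructor
  · intro h
    refine ⟨?_, ?_, ?_, ?_, ?_, ?_⟩ <;> exact h.ne (by decide)
  · rintro ⟨h1, h2, h3, h4, h5, h6⟩ a b hab
    fin_cases a <;> fin_cases b <;> simp_all

lemma forall_top_adj_fin_four_iff {V : Type*} (G : SimpleGraph V) (f : Fin 4 → V) :
    (∀ a b, (⊤ : SimpleGraph (Fin 4)).Adj a b → G.Adj (f a) (f b)) ↔
      G.Adj (f 0) (f 1) ∧ G.Adj (f 0) (f 2) ∧ G.Adj (f 0) (f 3) ∧ G.Adj (f 1) (f 2) ∧
        G.Adj (f 1) (f 3) ∧ G.Adj (f 2) (f 3) := by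
  constructor
  · intro h
    refine ⟨?_, ?_, ?_, ?_, ?_, ?_⟩ <;> exact h _ _ (by decide)
  · rintro ⟨h1, h2, h3, h4, h5, h6⟩ a b hab
    fin_cases a <;> fin_cases b <;> first
      | assumption | exact h1.symm | exact h2.symm | exact h3.symm | exact h4.symm
      | exact h5.symm | exact h6.symm | exact absurd rfl hab

lemma forall_cycleGraph_four_adj_iff {V : Type*} (G : SimpleGraph V) (f : Fin 4 → V) :
    (∀ a b, (cycleGraph 4).Adj a b → G.Adj (f a) (f b)) ↔
      G.Adj (f 0) (f 1) ∧ G.Adj (f 1) (f 2) ∧ G.Adj (f 2) (f 3) ∧ G.Adj (f 3) (f 0) := by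
  constructor
  · intro h
    refine ⟨?_, ?_, ?_, ?_⟩ <;> exact h _ _ (by decide)
  · rintro ⟨h1, h2, h3, h4⟩ a b hab
    revert hab
    fin_cases a <;> fin_cases b <;> intro hab <;>
      first
      | assumption | exact h1.symm | exact h2.symm | exact h3.symm | exact h4.symm
      | exact absurd hab (by decide)

variable {V ι : Type*} [Fintype V] [DecidableEq ι] (c : V → ι)

lemma labelledCopyCount_top_two : ((⊤ : SimpleGraph ι).comap c).labelledCopyCount
    (⊤ : SimpleGraph (Fin 2)) = (Finset.univ.filter fun q : V × V => c q.1 ≠ c q.2).card := by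
  classical
  rw [labelledCopyCount_eq_card, Nat.card_eq_fintype_card, Fintype.card_subtype]
  refine Finset.card_equiv (finTwoArrowEquiv V) fun f => ?_
  simp only [Finset.mem_filter, Finset.mem_univ, true_and]
  change _ ↔ c (f 0) ≠ c (f 1)
  constructor
  · intro h
    exact h.2 0 1 (by decide)
  · intro h
    have h' : f 0 ≠ f 1 := fun h0 => h (congrArg c h0)
    refine ⟨fun a b hab => ?_, fun a b hab => ?_⟩
    · fin_cases a <;> fin_cases b <;> simp_all
    · fin_cases a <;> fin_cases b <;>
        first | exact h | exact h.symm | simp at hab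

lemma labelledCopyCount_top_four : ((⊤ : SimpleGraph ι).comap c).labelledCopyCount
    (⊤ : SimpleGraph (Fin 4)) = ∑ q : (V × V) × (V × V),
      if c q.1.1 ≠ c q.1.2 ∧ c q.1.1 ≠ c q.2.1 ∧ c q.1.1 ≠ c q.2.2 ∧ c q.1.2 ≠ c q.2.1 ∧
        c q.1.2 ≠ c q.2.2 ∧ c q.2.1 ≠ c q.2.2 then 1 else 0 := by
  classical
  rw [labelledCopyCount_eq_card, Nat.card_eq_fintype_card, Fintype.card_subtype,
    ← Finset.card_filter]
  refine Finset.card_equiv (finFourArrowEquiv V) fun f => ?_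
  simp only [Finset.mem_filter, Finset.mem_univ, true_and]
  rw [injective_fin_four_iff, forall_top_adj_fin_four_iff]
  simp only [comap_adj, top_adj, finFourArrowEquiv_apply]
  exact ⟨fun h => h.2, fun h => ⟨⟨ne_of_apply_ne c h.1, ne_of_apply_ne c h.2.1,
    ne_of_apply_ne c h.2.2.1, ne_of_apply_ne c h.2.2.2.1, ne_of_apply_ne c h.2.2.2.2.1,
    ne_of_apply_ne c h.2.2.2.2.2⟩, h⟩⟩

lemma labelledCopyCount_cycle_four [DecidableEq V] :
    ((⊤ : SimpleGraph ι).comap c).labelledCopyCount (cycleGraph 4) = ∑ q : (V × V) × (V × V),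
      if c q.1.1 ≠ c q.1.2 ∧ c q.1.2 ≠ c q.2.1 ∧ c q.2.1 ≠ c q.2.2 ∧ c q.2.2 ≠ c q.1.1 ∧
        q.1.1 ≠ q.2.1 ∧ q.1.2 ≠ q.2.2 then 1 else 0 := by
  classical
  rw [labelledCopyCount_eq_card, Nat.card_eq_fintype_card, Fintype.card_subtype,
    ← Finset.card_filter]
  refine Finset.card_equiv (finFourArrowEquiv V) fun f => ?_
  simp only [Finset.mem_filter, Finset.mem_univ, true_and]
  rw [injective_fin_four_iff, forall_cycleGraph_four_adj_iff]
  simp only [comap_adj, top_adj, finFourArrowEquiv_apply]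
  constructor
  · rintro ⟨⟨-, h02, -, -, h13, -⟩, h1, h2, h3, h4⟩
    exact ⟨h1, h2, h3, h4, h02, h13⟩
  · rintro ⟨h1, h2, h3, h4, h02, h13⟩
    exact ⟨⟨ne_of_apply_ne c h1, h02, (ne_of_apply_ne c h4).symm, ne_of_apply_ne c h2, h13,
      ne_of_apply_ne c h3⟩, h1, h2, h3, h4⟩

/-- Two prescribed coordinates of a quadruple coincide for at most `|V| ^ 3` quadruples. -/
lemma card_eq_coord_le [DecidableEq V] {A : Type*} [Fintype A] (f g : A → V)
    (h : A → V × V) (hinj : Function.Injective fun a => (f a, g a, h a)) :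
    (∑ a, if f a = g a then 1 else 0) ≤ Fintype.card V ^ 3 := by
  rw [← Finset.card_filter]
  have h3 : Fintype.card V ^ 3 = (Finset.univ : Finset (V × V × V)).card := by
    simp only [Finset.card_univ, Fintype.card_prod]
    ring
  rw [h3]
  refine Finset.card_le_card_of_injOn (fun a => (f a, h a)) (fun _ _ => Finset.mem_univ _) ?_
  intro a ha b hb hab
  have ha : f a = g a := by simpa using ha
  have hb : f b = g b := by simpa using hb
  have h1 : f a = f b := congrArg Prod.fst hab
  have h2 : h a = h b := congrArg Prod.snd hab
  refine hinj ?_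
  simp only [← ha, ← hb, h1, h2]

/-- Two disjoint edges `xy` and `zw` of a complete multipartite graph span both of the 4-cycles
`xyzw` and `xywz` if they span a clique, and exactly one of them otherwise. The last four terms
allow for edges that share a vertex. -/
lemma two_edges_add_clique_le {V ι : Type*} [DecidableEq V] [DecidableEq ι] (c : V → ι)
    (x y z w : V) :
    (if c x ≠ c y ∧ c z ≠ c w then 1 else 0) +
      (if c x ≠ c y ∧ c x ≠ c z ∧ c x ≠ c w ∧ c y ≠ c z ∧ c y ≠ c w ∧ c z ≠ c w
        then 1 else 0) ≤
    (if c x ≠ c y ∧ c y ≠ c z ∧ c z ≠ c w ∧ c w ≠ c x ∧ x ≠ z ∧ y ≠ w then 1 else 0) +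
      (if c x ≠ c y ∧ c y ≠ c w ∧ c w ≠ c z ∧ c z ≠ c x ∧ x ≠ w ∧ y ≠ z then 1 else 0) +
      ((if x = z then 1 else 0) + (if x = w then 1 else 0) +
        ((if y = z then 1 else 0) + (if y = w then 1 else 0))) := by
  by_cases hE : c x ≠ c y ∧ c z ≠ c w
  swap
  · rw [if_neg hE, if_neg fun h => hE ⟨h.1, h.2.2.2.2.2⟩]
    exact Nat.zero_le _
  obtain ⟨hxy, hzw⟩ := hE
  rw [if_pos ⟨hxy, hzw⟩]
  by_cases hxz : x = z
  · rw [if_neg fun h => h.2.1 (congrArg c hxz), if_pos hxz]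
    omega
  by_cases hxw : x = w
  · rw [if_neg fun h => h.2.2.1 (congrArg c hxw), if_pos hxw]
    omega
  by_cases hyz : y = z
  · rw [if_neg fun h => h.2.2.2.1 (congrArg c hyz), if_pos hyz]
    omega
  by_cases hyw : y = w
  · rw [if_neg fun h => h.2.2.2.2.1 (congrArg c hyw), if_pos hyw]
    omega
  by_cases h1 : c y ≠ c z ∧ c w ≠ c x
  · have hC : c x ≠ c y ∧ c y ≠ c z ∧ c z ≠ c w ∧ c w ≠ c x ∧ x ≠ z ∧ y ≠ w :=
      ⟨hxy, h1.1, hzw, h1.2, hxz, hyw⟩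
    rw [if_pos hC]
    by_cases h2 : c y ≠ c w ∧ c z ≠ c x
    · have hC' : c x ≠ c y ∧ c y ≠ c w ∧ c w ≠ c z ∧ c z ≠ c x ∧ x ≠ w ∧ y ≠ z :=
        ⟨hxy, h2.1, hzw.symm, h2.2, hxw, hyz⟩
      rw [if_pos hC']
      split_ifs <;> omega
    · rw [if_neg fun h => h2 ⟨h.2.2.2.2.1, h.2.1.symm⟩]
      omega
  · have h2 : c y ≠ c w ∧ c z ≠ c x := by grind
    have hC' : c x ≠ c y ∧ c y ≠ c w ∧ c w ≠ c z ∧ c z ≠ c x ∧ x ≠ w ∧ y ≠ z :=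
      ⟨hxy, h2.1, hzw.symm, h2.2, hxw, hyz⟩
    rw [if_pos hC', if_neg fun h => h1 ⟨h.2.2.2.1, h.2.2.1.symm⟩]
    omega

/-- The numbers of edges and of 4-cliques in a complete multipartite graph bound the number of
4-cycles from below. The term `4 * |V| ^ 3` covers the pairs of edges that share a vertex. -/
theorem edge_sq_add_clique_four_le :
    ((⊤ : SimpleGraph ι).comap c).labelledCopyCount (⊤ : SimpleGraph (Fin 2)) ^ 2 +
      ((⊤ : SimpleGraph ι).comap c).labelledCopyCount (⊤ : SimpleGraph (Fin 4)) ≤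
    2 * ((⊤ : SimpleGraph ι).comap c).labelledCopyCount (cycleGraph 4) +
      4 * Fintype.card V ^ 3 := by
  classical
  have hE : ((⊤ : SimpleGraph ι).comap c).labelledCopyCount (⊤ : SimpleGraph (Fin 2)) ^ 2 =
      ∑ q : (V × V) × (V × V), if c q.1.1 ≠ c q.1.2 ∧ c q.2.1 ≠ c q.2.2 then 1 else 0 := by
    rw [labelledCopyCount_top_two, sq, ← Finset.card_product, ← Finset.card_filter]
    congr 1
    ext q
    simp
  -- The second 4-cycle on the same two edges arises from the first by reversing an edge.
  have hC : ((⊤ : SimpleGraph ι).comap c).labelledCopyCount (cycleGraph 4) =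
      ∑ q : (V × V) × (V × V),
        if c q.1.1 ≠ c q.1.2 ∧ c q.1.2 ≠ c q.2.2 ∧ c q.2.2 ≠ c q.2.1 ∧ c q.2.1 ≠ c q.1.1 ∧
          q.1.1 ≠ q.2.2 ∧ q.1.2 ≠ q.2.1 then 1 else 0 := by
    rw [labelledCopyCount_cycle_four,
      ← Equiv.sum_comp ((Equiv.refl (V × V)).prodCongr (Equiv.prodComm V V))]
    rfl
  have h1 := card_eq_coord_le (fun q : (V × V) × (V × V) => q.1.1) (fun q => q.2.1)
    (fun q => (q.1.2, q.2.2)) (by rintro ⟨⟨_, _⟩, _, _⟩ ⟨⟨_, _⟩, _, _⟩ h; simp at h; simp [h])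
  have h2 := card_eq_coord_le (fun q : (V × V) × (V × V) => q.1.1) (fun q => q.2.2)
    (fun q => (q.1.2, q.2.1)) (by rintro ⟨⟨_, _⟩, _, _⟩ ⟨⟨_, _⟩, _, _⟩ h; simp at h; simp [h])
  have h3 := card_eq_coord_le (fun q : (V × V) × (V × V) => q.1.2) (fun q => q.2.1)
    (fun q => (q.1.1, q.2.2)) (by rintro ⟨⟨_, _⟩, _, _⟩ ⟨⟨_, _⟩, _, _⟩ h; simp at h; simp [h])
  have h4 := card_eq_coord_le (fun q : (V × V) × (V × V) => q.1.2) (fun q => q.2.2)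
    (fun q => (q.1.1, q.2.1)) (by rintro ⟨⟨_, _⟩, _, _⟩ ⟨⟨_, _⟩, _, _⟩ h; simp at h; simp [h])
  rw [two_mul]
  nth_rewrite 1 [labelledCopyCount_cycle_four]
  rw [hC, hE, labelledCopyCount_top_four]
  refine le_trans ?_ (Nat.add_le_add_left (m := _) (n := _)
    (show _ ≤ 4 * Fintype.card V ^ 3 by
      calc _ ≤ _ := Nat.add_le_add (Nat.add_le_add h1 h2) (Nat.add_le_add h3 h4)
        _ = _ := by ring) _)
  simp only [← Finset.sum_add_distrib]
  exact Finset.sum_le_sum fun q _ => two_edges_add_clique_le c q.1.1 q.1.2 q.2.1 q.2.2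

end MultipartiteCounts

/-! ### Sequences of complete multipartite graphs -/

section MultipartiteSequences

open SimpleGraph Topology

/-- Some vertex lies in a part at least as large as the average over the vertices, which the number
of edges determines. -/
lemma exists_large_part {V ι : Type*} [Fintype V] [Nonempty V] [DecidableEq ι] (c : V → ι) :
    ∃ v, Fintype.card V ^ 2 ≤ ((⊤ : SimpleGraph ι).comap c).labelledCopyCount
        (⊤ : SimpleGraph (Fin 2)) +
      Fintype.card V * (Finset.univ.filter fun w => c w = c v).card := by
  classical
  obtain ⟨v, -, hv⟩ := Finset.exists_max_image Finset.univ
    (fun v => (Finset.univ.filter fun w => c w = c v).card) Finset.univ_nonempty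
  refine ⟨v, ?_⟩
  have h1 : (Finset.univ.filter fun q : V × V => ¬ c q.1 ≠ c q.2).card ≤
      Fintype.card V * (Finset.univ.filter fun w => c w = c v).card := by
    have : (Finset.univ.filter fun q : V × V => ¬ c q.1 ≠ c q.2).card =
        ∑ x : V, (Finset.univ.filter fun w => c w = c x).card := by
      simp only [Finset.card_filter, Fintype.sum_prod_type, not_not, eq_comm]
    rw [this, ← smul_eq_mul, ← Finset.card_univ]
    exact Finset.sum_le_card_nsmul _ _ _ fun x _ => hv x (Finset.mem_univ _)
  have h2 := Finset.card_filter_add_card_filter_not (s := Finset.univ)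
    (fun q : V × V => c q.1 ≠ c q.2)
  rw [labelledCopyCount_top_two, sq, ← Fintype.card_prod, ← Finset.card_univ, ← h2]
  omega

/-- A complete multipartite graph with approximately the right clique densities, obtained by
rounding the sizes of the parts prescribed by `exists_weights`. -/
theorem exists_multipartite_approx {p : ℝ} (hp : 0 < p) (hp1 : p < 1) {N : ℕ} (hN : 0 < N)
    {ε : ℝ} (hε : 0 < ε) :
    ∃ n, N ≤ n ∧ ∃ c : Fin n → Fin N, ∀ j ≤ N,
      |(((⊤ : SimpleGraph (Fin N)).comap c).labelledCopyCount (⊤ : SimpleGraph (Fin j)) : ℝ) /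
          (n : ℝ) ^ j - p ^ j.choose 2 * ((N.descFactorial j : ℝ) / (N : ℝ) ^ j)| < ε := by
  obtain ⟨α, hα, hsum⟩ := exists_weights hp hp1 N
  have hone : ∑ i, α i = 1 := by
    have h := hsum 1
    rw [sum_embedding_prod, Finset.powersetCard_one, Finset.sum_map] at h
    have hN' : (N : ℝ) ≠ 0 := by positivity
    simpa [hN'] using h
  set m : ℕ → Fin N → ℕ := fun M i => ⌊α i * (M : ℝ)⌋₊ with hm
  have hlim : ∀ i, Tendsto (fun M : ℕ => (m M i : ℝ) / M) atTop (𝓝 (α i)) := fun i =>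
    (tendsto_nat_floor_mul_div_atTop (hα i)).comp tendsto_natCast_atTop_atTop
  have hn : Tendsto (fun M : ℕ => ((∑ i, m M i : ℕ) : ℝ) / M) atTop (𝓝 1) := by
    rw [← hone]
    push_cast
    simp only [Finset.sum_div]
    exact tendsto_finsetSum _ fun i _ => hlim i
  have hne : ∀ᶠ M : ℕ in atTop, (M : ℝ) ≠ 0 :=
    (eventually_ne_atTop 0).mono fun M hM => Nat.cast_ne_zero.2 hM
  have htop : Tendsto (fun M : ℕ => ∑ i, m M i) atTop atTop := by
    rw [← tendsto_natCast_atTop_iff (R := ℝ)]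
    refine (hn.pos_mul_atTop one_pos tendsto_natCast_atTop_atTop).congr' ?_
    filter_upwards [hne] with M hM
    exact div_mul_cancel₀ _ hM
  have hcount : ∀ j : ℕ, Tendsto (fun M : ℕ => ((∑ g : Fin j ↪ Fin N, ∏ a, m M (g a) : ℕ) : ℝ) /
      ((∑ i, m M i : ℕ) : ℝ) ^ j) atTop
      (𝓝 (p ^ j.choose 2 * ((N.descFactorial j : ℝ) / (N : ℝ) ^ j))) := fun j => by
    have h1 : Tendsto (fun M : ℕ => ∑ g : Fin j ↪ Fin N, ∏ a, ((m M (g a) : ℝ) / M)) atTop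
        (𝓝 (∑ g : Fin j ↪ Fin N, ∏ a, α (g a))) :=
      tendsto_finsetSum _ fun g _ => tendsto_finsetProd _ fun a _ => hlim (g a)
    have h2 := h1.div (hn.pow j) (by simp)
    rw [hsum, one_pow, div_one] at h2
    refine h2.congr' ?_
    filter_upwards [hne] with M hM
    have h3 : ∑ g : Fin j ↪ Fin N, ∏ a, ((m M (g a) : ℝ) / M) =
        ((∑ g : Fin j ↪ Fin N, ∏ a, m M (g a) : ℕ) : ℝ) / (M : ℝ) ^ j := by
      push_cast
      rw [Finset.sum_div]
      refine Finset.sum_congr rfl fun g _ => ?_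
      rw [Finset.prod_div_distrib]
      simp
    rw [Pi.div_apply, h3, div_pow, div_div_div_cancel_right₀ (pow_ne_zero _ hM)]
  have hclose : ∀ᶠ M : ℕ in atTop, ∀ j ∈ Finset.range (N + 1),
      |((∑ g : Fin j ↪ Fin N, ∏ a, m M (g a) : ℕ) : ℝ) / ((∑ i, m M i : ℕ) : ℝ) ^ j -
        p ^ j.choose 2 * ((N.descFactorial j : ℝ) / (N : ℝ) ^ j)| < ε := by
    rw [Filter.eventually_all_finset]
    intro j _
    filter_upwards [Metric.tendsto_nhds.1 (hcount j) ε hε] with M hM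
    rwa [Real.dist_eq] at hM
  obtain ⟨M, hM, hMN⟩ := (hclose.and (htop.eventually_ge_atTop N)).exists
  obtain ⟨c, hc⟩ := exists_colouring (m M)
  refine ⟨_, hMN, c, fun j hj => ?_⟩
  rw [labelledCopyCount_top_comap]
  simp only [hc]
  exact hM j (Finset.mem_range.2 (by omega))

lemma isEquivalent_const_mul_pow_iff {u : ℕ → ℝ} {n : ℕ → ℕ} (hn : Tendsto n atTop atTop)
    {a : ℝ} (ha : a ≠ 0) (m : ℕ) :
    (u ~[atTop] fun k => a * (n k : ℝ) ^ m) ↔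
      Tendsto (fun k => u k / (n k : ℝ) ^ m) atTop (𝓝 a) := by
  have hne : ∀ᶠ k in atTop, a * (n k : ℝ) ^ m ≠ 0 :=
    (hn.eventually_ne_atTop 0).mono fun k hk =>
      mul_ne_zero ha (pow_ne_zero _ (Nat.cast_ne_zero.2 hk))
  rw [isEquivalent_iff_tendsto_one hne]
  constructor
  · intro h
    have := h.const_mul a
    rw [mul_one] at this
    refine this.congr fun k => ?_
    rw [Pi.div_apply, ← mul_div_assoc, mul_div_mul_left _ _ ha]
  · intro h
    have := h.div_const a
    rw [div_self ha] at this
    refine this.congr fun k => ?_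
    rw [Pi.div_apply, div_div, mul_comm]

lemma ncard_edgeSet_top (j : ℕ) : (⊤ : SimpleGraph (Fin j)).edgeSet.ncard = j.choose 2 := by
  rw [← coe_edgeFinset, Set.ncard_coe_finset, card_edgeFinset_top_eq_card_choose_two,
    Fintype.card_fin]

lemma ncard_edgeSet_cycleGraph_four : (cycleGraph 4).edgeSet.ncard = 4 := by
  rw [← coe_edgeFinset, Set.ncard_coe_finset]
  decide

/-- Complete multipartite graphs with the right numbers of edges and of 4-cliques have
asymptotically at least `(p ^ 2 + p ^ 6) / 2 * n ^ 4` labelled 4-cycles, which is too many. -/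
theorem not_isEquivalent_cycleGraph_four {p : ℝ} (hp : 0 < p) (hp1 : p < 1) {n : ℕ → ℕ}
    (hn : Tendsto n atTop atTop) {ι : ℕ → Type*} (c : (k : ℕ) → Fin (n k) → ι k)
    (h2 : Tendsto (fun k => (((⊤ : SimpleGraph (ι k)).comap (c k)).labelledCopyCount
      (⊤ : SimpleGraph (Fin 2)) : ℝ) / (n k : ℝ) ^ 2) atTop (𝓝 p))
    (h4 : Tendsto (fun k => (((⊤ : SimpleGraph (ι k)).comap (c k)).labelledCopyCount
      (⊤ : SimpleGraph (Fin 4)) : ℝ) / (n k : ℝ) ^ 4) atTop (𝓝 (p ^ 6))) :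
    ¬ (fun k => (((⊤ : SimpleGraph (ι k)).comap (c k)).labelledCopyCount (cycleGraph 4) : ℝ))
      ~[atTop] (fun k => p ^ 4 * (n k : ℝ) ^ 4) := by
  classical
  intro hC
  rw [isEquivalent_const_mul_pow_iff hn (by positivity)] at hC
  have hinv : Tendsto (fun k => 4 / (n k : ℝ)) atTop (𝓝 0) :=
    (tendsto_natCast_atTop_atTop.comp hn).const_div_atTop 4
  have hle : p ^ 2 + p ^ 6 ≤ 2 * p ^ 4 + 0 := by
    refine le_of_tendsto_of_tendsto ((h2.pow 2).add h4) ((hC.const_mul 2).add hinv) ?_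
    filter_upwards [hn.eventually_ne_atTop 0] with k hk
    have hk' : (n k : ℝ) ≠ 0 := Nat.cast_ne_zero.2 hk
    have h := edge_sq_add_clique_four_le (c k)
    rw [Fintype.card_fin] at h
    have h' := div_le_div_of_nonneg_right (Nat.cast_le (α := ℝ).2 h)
      (show (0 : ℝ) ≤ (n k : ℝ) ^ 4 by positivity)
    push_cast at h'
    convert h' using 1 <;> field_simp
  nlinarith [mul_pos (pow_pos hp 2) (pow_pos (show 0 < 1 - p ^ 2 by nlinarith) 2)]

open LargeGraph in
/-- A set without edges that contains a positive proportion of the vertices violates the edge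
distribution property. -/
lemma not_propertyThree_of_isIndepSet {G : LargeGraph} {p c : ℝ} (hp : 0 < p) (hc : 0 < c)
    (h : ∀ k, ∃ S : Finset (Fin (G.order k)),
      (G.graph k).IsIndepSet (S : Set (Fin (G.order k))) ∧ c * (G.order k : ℝ) ≤ (S.card : ℝ)) :
    ¬ G.PropertyThree p := by
  intro h3
  obtain ⟨k, hk, hpos⟩ := ((h3 c hc (1 / 2) (by norm_num)).and
    (G.tendsto_order.eventually_gt_atTop 0)).exists
  obtain ⟨S, hS, hcard⟩ := h k
  have hzero : labeledEdgesIn (G.graph k) S = 0 := by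
    rw [labeledEdgesIn, Set.ncard_eq_zero]
    ext ⟨x, y⟩
    simp only [Set.mem_ofPred_eq, Set.mem_empty_iff_false, iff_false]
    rintro ⟨hx, hy, hxy⟩
    exact hS hx hy hxy.ne hxy
  have := hk S hcard
  have hSpos : 0 < (S.card : ℝ) := lt_of_lt_of_le (by positivity) hcard
  have hpS : 0 < p * (S.card : ℝ) ^ 2 := by positivity
  rw [hzero, Nat.cast_zero, zero_sub, abs_neg, abs_of_pos hpS] at this
  linarith

/-- A sequence of complete multipartite graphs that has the right number of cliques of each size but
is not quasirandom. -/
theorem exists_largeGraph {p : ℝ} (hp : 0 < p) (hp1 : p < 1) :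
    ∃ G : LargeGraph,
      (∀ j : ℕ, 2 ≤ j →
        (fun k => ((G.graph k).labelledCopyCount (⊤ : SimpleGraph (Fin j)) : ℝ)) ~[atTop]
          (fun k => p ^ j.choose 2 * (G.order k : ℝ) ^ j)) ∧
      (∀ k : ℕ, ∃ S : Finset (Fin (G.order k)),
        (G.graph k).IsIndepSet (S : Set (Fin (G.order k))) ∧
          (1 - p) * (G.order k : ℝ) / 2 ≤ (S.card : ℝ)) ∧
      ¬ G.IsQuasirandom p := by
  -- The bound `(1 - p) / 2` on the error in the edge density leaves a part of size `(1 - p) n / 2`.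
  have hε : ∀ k : ℕ, 0 < min (1 / ((k : ℝ) + 1)) ((1 - p) / 2) := fun k =>
    lt_min (by positivity) (by linarith)
  have hex := fun k : ℕ => exists_multipartite_approx hp hp1 (N := k + 2) (by omega) (hε k)
  choose n hn c hc using hex
  have hntop : Tendsto n atTop atTop :=
    tendsto_atTop_mono (fun k => (Nat.le_add_right k 2).trans (hn k)) tendsto_id
  have hlim : ∀ j : ℕ, Tendsto (fun k =>
      (((⊤ : SimpleGraph (Fin (k + 2))).comap (c k)).labelledCopyCount
        (⊤ : SimpleGraph (Fin j)) : ℝ) / (n k : ℝ) ^ j) atTop (𝓝 (p ^ j.choose 2)) := fun j => by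
    have h1 : Tendsto (fun N : ℕ => (N.descFactorial j : ℝ) / (N : ℝ) ^ j) atTop (𝓝 1) := by
      refine (isEquivalent_iff_tendsto_one ?_).1 (isEquivalent_descFactorial j)
      filter_upwards [eventually_ne_atTop 0] with N hN
      exact pow_ne_zero _ (Nat.cast_ne_zero.2 hN)
    have h2 := (h1.comp (tendsto_add_atTop_nat 2)).const_mul (p ^ j.choose 2)
    rw [mul_one] at h2
    refine tendsto_of_tendsto_of_dist h2 ?_
    refine squeeze_zero' (Eventually.of_forall fun _ => dist_nonneg) ?_
      tendsto_one_div_add_atTop_nhds_zero_nat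
    filter_upwards [eventually_ge_atTop j] with k hk
    rw [_root_.dist_comm, Real.dist_eq]
    exact (hc k j (by omega)).le.trans (min_le_left _ _)
  have hindep : ∀ k, ∃ S : Finset (Fin (n k)),
      ((⊤ : SimpleGraph (Fin (k + 2))).comap (c k)).IsIndepSet (S : Set (Fin (n k))) ∧
        (1 - p) * (n k : ℝ) / 2 ≤ (S.card : ℝ) := fun k => by
    have hpos : 0 < n k := lt_of_lt_of_le (by omega) (hn k)
    have : Nonempty (Fin (n k)) := ⟨⟨0, hpos⟩⟩
    obtain ⟨v, hv⟩ := exists_large_part (c k)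
    refine ⟨Finset.univ.filter fun w => c k w = c k v, fun x hx y hy _ hxy => ?_, ?_⟩
    · have hx : c k x = c k v := by simpa using hx
      have hy : c k y = c k v := by simpa using hy
      exact hxy (hx.trans hy.symm)
    · have hnR : (0 : ℝ) < n k := Nat.cast_pos.2 hpos
      have h1 := (abs_lt.1 ((hc k 2 (by omega)).trans_le (min_le_right _ _))).2
      have h2 : (((k + 2).descFactorial 2 : ℕ) : ℝ) / ((k + 2 : ℕ) : ℝ) ^ 2 ≤ 1 := by
        rw [div_le_one (by positivity)]
        exact_mod_cast Nat.descFactorial_le_pow (k + 2) 2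
      have h3 : p * ((((k + 2).descFactorial 2 : ℕ) : ℝ) / ((k + 2 : ℕ) : ℝ) ^ 2) ≤ p :=
        mul_le_of_le_one_right hp.le h2
      rw [Nat.choose_self, pow_one] at h1
      have h4 : (((⊤ : SimpleGraph (Fin (k + 2))).comap (c k)).labelledCopyCount
          (⊤ : SimpleGraph (Fin 2)) : ℝ) / (n k : ℝ) ^ 2 ≤ (1 + p) / 2 := by linarith
      rw [div_le_iff₀ (by positivity)] at h4
      rw [Fintype.card_fin] at hv
      have hv' := Nat.cast_le (α := ℝ).2 hv
      push_cast at hv'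
      refine le_of_mul_le_mul_left ?_ hnR
      linarith
  refine ⟨⟨n, fun k => (⊤ : SimpleGraph (Fin (k + 2))).comap (c k), hntop⟩, fun j _ => ?_,
    hindep, ?_⟩
  · exact (isEquivalent_const_mul_pow_iff hntop (pow_pos hp _).ne' j).2 (hlim j)
  · have hC := not_isEquivalent_cycleGraph_four hp hp1 hntop c
      (by simpa using hlim 2) (hlim 4)
    rintro (h | h | h)
    · exact hC h.2
    · have h := h 4 (cycleGraph 4)
      rw [LargeGraph.HasCorrectCount, ncard_edgeSet_cycleGraph_four] at h
      exact hC h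
    · refine not_propertyThree_of_isIndepSet hp (c := (1 - p) / 2) (by linarith) (fun k => ?_) h
      obtain ⟨S, hS, hcard⟩ := hindep k
      exact ⟨S, hS, by rwa [div_mul_eq_mul_div]⟩

end MultipartiteSequences

/-! ### Cliques are not forcing -/

theorem mainTheorem1 :
    ¬ GraphFamily.IsForcing GraphFamily.cliques ∧
    ∀ p : ℝ, 0 < p → p < 1 →
      ¬ GraphFamily.IsForcingAt GraphFamily.cliques p ∧
      ∃ G : LargeGraph,
        (∀ j : ℕ, 2 ≤ j →
          (fun k => ((G.graph k).labelledCopyCount (⊤ : SimpleGraph (Fin j)) : ℝ)) ~[atTop]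
            (fun k => p ^ j.choose 2 * (G.order k : ℝ) ^ j)) ∧
        (∀ k : ℕ, ∃ S : Finset (Fin (G.order k)),
          (G.graph k).IsIndepSet (S : Set (Fin (G.order k))) ∧
            (1 - p) * (G.order k : ℝ) / 2 ≤ (S.card : ℝ)) ∧
        ¬ G.IsQuasirandom p := by
  have key : ∀ p : ℝ, 0 < p → p < 1 → ¬ GraphFamily.IsForcingAt GraphFamily.cliques p := by
    intro p hp hp1 hforcing
    obtain ⟨G, hG, -, hnot⟩ := exists_largeGraph hp hp1
    refine hnot (hforcing G ?_)
    rintro _ ⟨j, hj, rfl⟩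
    rw [LargeGraph.HasCorrectCount, ncard_edgeSet_top]
    exact hG j hj
  exact ⟨fun h => key (1 / 2) (by norm_num) (by norm_num) (h _ (by norm_num) (by norm_num)),
    fun p hp hp1 => ⟨key p hp hp1, exists_largeGraph hp hp1⟩⟩
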